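/- Let $n\ge 1$ and let $X$ be a random vector in $\mathbb R^n$ whose law has a density $f$ with respect to Lebesgue measure, where $f:\mathbb R^n\to[0,\infty)$ is log-concave, i.e. $f(ax+by)\ge f(x)^a f(y)^b$ for all $x,y\in\mathbb R^n$ and all $a,b>0$ with $a+b=1$. Then $\mathbb E|\log f(X)|<\infty$, and $$\mathbb E\exp\Bigl\{\frac{\alpha}{\sqrt n}\,\bigl|\log f(X)-\mathbb E\log f(X)\bigr|\Bigr\}\le 3e^{4\alpha^2}\qquad\text{for all } 0\le\alpha\le\tfrac14\sqrt n .$$ -/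

import Mathlib

open MeasureTheory

/-- A nonnegative function `f` on a real vector space is log-concave if
`f (a x + b y) ≥ f x ^ a * f y ^ b` for all points `x, y` and all weights `a, b > 0` with
`a + b = 1`. Zeros of `f` are allowed: with positive exponents `0 ^ a = 0`, so the inequality is
void when `f x = 0` or `f y = 0`, and it says that `{f > 0}` is convex and that `log f` is concave
on this set. -/
structure LogConcave {E : Type*} [AddCommGroup E] [Module ℝ E] (f : E → ℝ) : Prop where
  nonneg : ∀ x, 0 ≤ f x
  rpow_mul_rpow_le : ∀ (x y : E) (a b : ℝ), 0 < a → 0 < b → a + b = 1 →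
    f x ^ a * f y ^ b ≤ f (a • x + b • y)

/-- The random vector `X : Ω → ℝⁿ` has density `f ≥ 0` with respect to Lebesgue measure: `X` and `f`
are (almost everywhere) measurable, and the law of `X` is the measure `f(x) dx`. -/
structure HasLebesgueDensity {Ω : Type*} [MeasurableSpace Ω] (P : Measure Ω) {n : ℕ}
    (X : Ω → EuclideanSpace ℝ (Fin n)) (f : EuclideanSpace ℝ (Fin n) → ℝ) : Prop where
  aemeasurable_vector : AEMeasurable X P
  aemeasurable_density : AEMeasurable f volume
  nonneg : ∀ x, 0 ≤ f x
  map_eq : P.map X = volume.withDensity (fun x => ENNReal.ofReal (f x))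

/-!
Let `d` be the dimension. By the Prékopa–Leindler inequality, applied to the perspective
`(x, t) ↦ f (x / t) ^ t`, the function `t ↦ t ^ d * ∫ f ^ t` is log-concave on `(0, ∞)`. Since
`∫ f ^ (1 + t) = E exp (t log f(X))`, this says that `d log (1 + t)` plus the cumulant generating
function of `log f(X)` is concave on `(-1, ∞)`; its tangent line at `0` bounds the centered
cumulant generating function by `d (t - log (1 + t)) ≤ 4 d t ^ 2` for `t ≥ -3/4`. Adding the bounds
for `t` and `-t` controls the exponential moment of the absolute value.
-/

open ProbabilityTheory
open scoped Pointwise ENNReal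

section OneDimensional

theorem volume_add_volume_le_volume_add_of_isCompact {K L : Set ℝ} (hK : IsCompact K)
    (hL : IsCompact L) (hK₀ : K.Nonempty) (hL₀ : L.Nonempty) :
    volume K + volume L ≤ volume (K + L) := by
  obtain ⟨m, hmK, hm⟩ := hK.exists_isGreatest hK₀
  obtain ⟨l, hlL, hl⟩ := hL.exists_isLeast hL₀
  have hsub : (l +ᵥ K) ∪ (m +ᵥ L) ⊆ K + L := by
    rintro z (⟨k, hk, rfl⟩ | ⟨y, hy, rfl⟩)
    · exact ⟨k, hk, l, hlL, add_comm k l⟩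
    · exact ⟨m, hmK, y, hy, rfl⟩
  have hdisj : AEDisjoint volume (l +ᵥ K) (m +ᵥ L) := by
    refine measure_mono_null (t := {m + l}) ?_ (measure_singleton _)
    rintro _ ⟨⟨k, hk, rfl⟩, ⟨y, hy, hyk⟩⟩
    simp only [vadd_eq_add, Set.mem_singleton_iff] at hyk ⊢
    linarith [hm hk, hl hy]
  calc volume K + volume L = volume (l +ᵥ K) + volume (m +ᵥ L) := by
        rw [measure_vadd, measure_vadd]
    _ = volume ((l +ᵥ K) ∪ (m +ᵥ L)) :=
        (measure_union₀ (hL.vadd m).measurableSet.nullMeasurableSet hdisj).symm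
    _ ≤ volume (K + L) := measure_mono hsub

theorem volume_add_volume_le_volume_add {A B : Set ℝ} (hA : MeasurableSet A)
    (hB : MeasurableSet B) (hA₀ : A.Nonempty) (hB₀ : B.Nonempty) :
    volume A + volume B ≤ volume (A + B) := by
  obtain ⟨a, ha⟩ := hA₀
  obtain ⟨b, hb⟩ := hB₀
  rw [hA.measure_eq_iSup_isCompact, hB.measure_eq_iSup_isCompact]
  simp only [iSup_and']
  refine ENNReal.biSup_add_biSup_le' ⟨∅, Set.empty_subset A, isCompact_empty⟩
    ⟨∅, Set.empty_subset B, isCompact_empty⟩ fun K ⟨hKA, hK⟩ L ⟨hLB, hL⟩ => ?_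
  calc volume K + volume L ≤ volume (insert a K) + volume (insert b L) := by
        gcongr <;> exact Set.subset_insert _ _
    _ ≤ volume (insert a K + insert b L) :=
        volume_add_volume_le_volume_add_of_isCompact (hK.insert a) (hL.insert b)
          (Set.insert_nonempty a K) (Set.insert_nonempty b L)
    _ ≤ volume (A + B) := measure_mono
        (Set.add_subset_add (Set.insert_subset ha hKA) (Set.insert_subset hb hLB))

theorem lintegral_eq_lintegral_meas_ofReal_lt {α : Type*} [MeasurableSpace α] (μ : Measure α)
    [SFinite μ] {f : α → ℝ≥0∞} (hf : Measurable f) :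
    ∫⁻ x, f x ∂μ = ∫⁻ t in Set.Ioi (0 : ℝ), μ {x | ENNReal.ofReal t < f x} := by
  have hslice (c : ℝ≥0∞) : volume.restrict (Set.Ioi 0) {t | ENNReal.ofReal t < c} = c := by
    rw [Measure.restrict_apply (measurableSet_lt ENNReal.measurable_ofReal measurable_const)]
    rcases eq_or_ne c ∞ with rfl | hc
    · simp
    · have hinter : {t | ENNReal.ofReal t < c} ∩ Set.Ioi 0 = Set.Ioo 0 c.toReal := by
        ext t
        simp only [Set.mem_inter_iff, Set.mem_ofPred_eq, Set.mem_Ioi, Set.mem_Ioo]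
        rw [and_comm]
        exact and_congr_right fun ht => ENNReal.ofReal_lt_iff_lt_toReal ht.le hc
      rw [hinter, Real.volume_Ioo, sub_zero, ENNReal.ofReal_toReal hc]
  have hmeas : MeasurableSet {p : α × ℝ | ENNReal.ofReal p.2 < f p.1} :=
    measurableSet_lt (ENNReal.measurable_ofReal.comp measurable_snd) (hf.comp measurable_fst)
  calc ∫⁻ x, f x ∂μ = ∫⁻ x, volume.restrict (Set.Ioi 0) {t | ENNReal.ofReal t < f x} ∂μ := by
        simp_rw [hslice]
    _ = μ.prod (volume.restrict (Set.Ioi 0)) {p | ENNReal.ofReal p.2 < f p.1} :=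
        (Measure.prod_apply hmeas).symm
    _ = ∫⁻ t in Set.Ioi (0 : ℝ), μ {x | ENNReal.ofReal t < f x} := Measure.prod_apply_symm hmeas

-- With equal suprema the superlevel sets of `f` and `g` are nonempty at the same heights, so that
-- Brunn–Minkowski applies at each of them.
theorem lintegral_add_lintegral_le_of_iSup_eq {f g h : ℝ → ℝ≥0∞} {a b : ℝ}
    (hf : Measurable f) (hg : Measurable g) (hh : Measurable h)
    (ha : 0 < a) (hb : 0 < b) (hab : a + b = 1)
    (hfgh : ∀ x y, f x ^ a * g y ^ b ≤ h (a • x + b • y)) (hsup : ⨆ x, f x = ⨆ x, g x) :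
    ENNReal.ofReal a * (∫⁻ x, f x) + ENNReal.ofReal b * (∫⁻ x, g x) ≤ ∫⁻ x, h x := by
  simp only [lintegral_eq_lintegral_meas_ofReal_lt volume, hf, hg, hh]
  refine (add_le_add (lintegral_const_mul_le _ _) (lintegral_const_mul_le _ _)).trans
    ((le_lintegral_add _ _).trans (setLIntegral_mono' measurableSet_Ioi fun t ht => ?_))
  set τ := ENNReal.ofReal t
  have hτ₀ : τ ≠ 0 := (ENNReal.ofReal_pos.2 ht).ne'
  rcases lt_or_ge τ (⨆ x, f x) with hτ | hτ
  · have hscale {c : ℝ} (hc : 0 < c) (s : Set ℝ) :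
        ENNReal.ofReal c * volume s = volume (c • s) := by
      simp [Measure.addHaar_smul, abs_of_pos hc]
    have hf_nonempty : {x | τ < f x}.Nonempty := lt_iSup_iff.1 hτ
    have hg_nonempty : {x | τ < g x}.Nonempty := lt_iSup_iff.1 (hτ.trans_eq hsup)
    have hsub : a • {x | τ < f x} + b • {y | τ < g y} ⊆ {z | τ < h z} := by
      rintro _ ⟨_, ⟨x, hx, rfl⟩, _, ⟨y, hy, rfl⟩, rfl⟩
      calc τ = τ ^ a * τ ^ b := by
            rw [← ENNReal.rpow_add _ _ hτ₀ ENNReal.ofReal_ne_top, hab, ENNReal.rpow_one]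
        _ < f x ^ a * g y ^ b :=
            ENNReal.mul_lt_mul (ENNReal.rpow_lt_rpow hx ha) (ENNReal.rpow_lt_rpow hy hb)
        _ ≤ h (a • x + b • y) := hfgh x y
    rw [hscale ha, hscale hb]
    exact (volume_add_volume_le_volume_add
      ((measurableSet_lt measurable_const hf).const_smul₀ a)
      ((measurableSet_lt measurable_const hg).const_smul₀ b)
      hf_nonempty.smul_set hg_nonempty.smul_set).trans (measure_mono hsub)
  · have hf_empty : {x | τ < f x} = ∅ :=
      Set.eq_empty_of_forall_notMem fun x => ((le_iSup f x).trans hτ).not_gt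
    have hg_empty : {x | τ < g x} = ∅ :=
      Set.eq_empty_of_forall_notMem fun x => ((le_iSup g x).trans (hsup ▸ hτ)).not_gt
    simp [hf_empty, hg_empty]

theorem ennreal_rpow_mul_rpow_le_add {a b : ℝ} (ha : 0 < a) (hb : 0 < b) (hab : a + b = 1)
    (u v : ℝ≥0∞) : u ^ a * v ^ b ≤ ENNReal.ofReal a * u + ENNReal.ofReal b * v := by
  have hpq : (a⁻¹).HolderConjugate b⁻¹ :=
    Real.holderConjugate_iff.2 ⟨(one_lt_inv₀ ha).2 (by linarith), by simpa using hab⟩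
  have hyoung := ENNReal.young_inequality (u ^ a) (v ^ b) hpq
  simpa [ENNReal.rpow_rpow_inv, ha.ne', hb.ne', ENNReal.ofReal_inv_of_pos, ha, hb,
    div_eq_mul_inv, mul_comm] using hyoung

theorem lintegral_rpow_mul_lintegral_rpow_le_of_iSup_ne_top {f g h : ℝ → ℝ≥0∞} {a b : ℝ}
    (hf : Measurable f) (hg : Measurable g) (hh : Measurable h)
    (ha : 0 < a) (hb : 0 < b) (hab : a + b = 1)
    (hfgh : ∀ x y, f x ^ a * g y ^ b ≤ h (a • x + b • y))
    (hf_top : ⨆ x, f x ≠ ∞) (hg_top : ⨆ x, g x ≠ ∞) :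
    (∫⁻ x, f x) ^ a * (∫⁻ x, g x) ^ b ≤ ∫⁻ x, h x := by
  rcases eq_or_ne (⨆ x, f x) 0 with hf₀ | hf₀
  · simp [ENNReal.iSup_eq_zero.1 hf₀, ha]
  rcases eq_or_ne (⨆ x, g x) 0 with hg₀ | hg₀
  · simp [ENNReal.iSup_eq_zero.1 hg₀, hb]
  set A := ⨆ x, f x
  set B := ⨆ x, g x
  set C := A ^ a * B ^ b with hC
  have hC₀ : C ≠ 0 := mul_ne_zero (by simp [hf₀, hf_top]) (by simp [hg₀, hg_top])
  have hC_top : C ≠ ∞ := ENNReal.mul_ne_top (ENNReal.rpow_ne_top_of_nonneg ha.le hf_top)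
    (ENNReal.rpow_ne_top_of_nonneg hb.le hg_top)
  have hsplit (u v : ℝ≥0∞) : (u / A) ^ a * (v / B) ^ b = u ^ a * v ^ b / C := by
    rw [ENNReal.div_rpow_of_nonneg _ _ ha.le, ENNReal.div_rpow_of_nonneg _ _ hb.le, hC,
      ENNReal.mul_div_mul_comm (.inl (by simp [hf₀, hf_top])) (.inl (by simp [hf₀, hf_top]))]
  have hsup : ⨆ x, f x / A = ⨆ x, g x / B := by
    rw [← ENNReal.iSup_div, ← ENNReal.iSup_div, ENNReal.div_self hf₀ hf_top,
      ENNReal.div_self hg₀ hg_top]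
  -- Dividing by the suprema makes them equal; AM–GM then gives the multiplicative form.
  have hadd := lintegral_add_lintegral_le_of_iSup_eq (hf.div_const A) (hg.div_const B)
    (hh.div_const C) ha hb hab
    (fun x y => (hsplit _ _).trans_le (ENNReal.div_le_div_right (hfgh x y) C)) hsup
  have hdiv (u : ℝ → ℝ≥0∞) (M : ℝ≥0∞) (hu : Measurable u) : ∫⁻ x, u x / M = (∫⁻ x, u x) / M := by
    simp only [div_eq_mul_inv, lintegral_mul_const _ hu]
  rw [hdiv f A hf, hdiv g B hg, hdiv h C hh] at hadd
  have hle := (ennreal_rpow_mul_rpow_le_add ha hb hab _ _).trans hadd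
  rwa [hsplit, ENNReal.div_le_iff hC₀ hC_top, ENNReal.div_mul_cancel hC₀ hC_top] at hle

end OneDimensional

/-- The measure `μ` on a real vector space satisfies the Prékopa–Leindler inequality. The functions
are `ℝ≥0∞`-valued so that the property passes to products by Tonelli's theorem, where a fibre
integral may be infinite. -/
def PrekopaLeindler {E : Type*} [AddCommGroup E] [Module ℝ E] [MeasurableSpace E]
    (μ : Measure E) : Prop :=
  ∀ ⦃f g h : E → ℝ≥0∞⦄ ⦃a b : ℝ⦄, Measurable f → Measurable g → Measurable h →
    0 < a → 0 < b → a + b = 1 → (∀ x y, f x ^ a * g y ^ b ≤ h (a • x + b • y)) →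
    (∫⁻ x, f x ∂μ) ^ a * (∫⁻ x, g x ∂μ) ^ b ≤ ∫⁻ x, h x ∂μ

namespace PrekopaLeindler

theorem volume_real : PrekopaLeindler (volume : Measure ℝ) := by
  intro f g h a b hf hg hh ha hb hab hfgh
  have htrunc {u : ℝ → ℝ≥0∞} (hu : Measurable u) :
      Filter.Tendsto (fun N : ℕ => ∫⁻ x, min (u x) N) Filter.atTop (nhds (∫⁻ x, u x)) := by
    refine lintegral_tendsto_of_tendsto_of_monotone
      (fun N => (hu.min measurable_const).aemeasurable)
      (.of_forall fun x M N hMN => min_le_min_left _ (Nat.cast_le.2 hMN)) (.of_forall fun x => ?_)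
    simpa using tendsto_const_nhds.min ENNReal.tendsto_nat_nhds_top
  have hbdd (u : ℝ → ℝ≥0∞) (N : ℕ) : ⨆ x, min (u x) N ≠ ∞ :=
    ne_top_of_le_ne_top (ENNReal.natCast_ne_top N) (iSup_le fun x => min_le_right _ _)
  rcases eq_or_ne (∫⁻ x, f x) 0 with hf₀ | hf₀
  · simp [hf₀, ha]
  rcases eq_or_ne (∫⁻ x, g x) 0 with hg₀ | hg₀
  · simp [hg₀, hb]
  refine le_of_tendsto (ENNReal.Tendsto.mul ((htrunc hf).ennrpow_const a)
    (.inl (by simp [hf₀, ha.not_gt])) ((htrunc hg).ennrpow_const b)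
    (.inl (by simp [hg₀, hb.not_gt]))) (.of_forall fun N => ?_)
  refine lintegral_rpow_mul_lintegral_rpow_le_of_iSup_ne_top (hf.min measurable_const)
    (hg.min measurable_const) hh ha hb hab (fun x y => ?_) (hbdd f N) (hbdd g N)
  calc min (f x) N ^ a * min (g y) N ^ b ≤ f x ^ a * g y ^ b := by
        gcongr <;> exact min_le_left _ _
    _ ≤ h (a • x + b • y) := hfgh x y

variable {E F : Type*} [AddCommGroup E] [Module ℝ E] [MeasurableSpace E]
  [AddCommGroup F] [Module ℝ F] [MeasurableSpace F] {μ : Measure E} {ν : Measure F}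

theorem dirac_zero : PrekopaLeindler (Measure.dirac (0 : E)) := by
  intro f g h a b hf hg hh _ _ _ hfgh
  simpa [lintegral_dirac' _ hf, lintegral_dirac' _ hg, lintegral_dirac' _ hh] using hfgh 0 0

theorem prod [SFinite ν] (hμ : PrekopaLeindler μ) (hν : PrekopaLeindler ν) :
    PrekopaLeindler (μ.prod ν) := by
  intro f g h a b hf hg hh ha hb hab hfgh
  rw [lintegral_prod _ hf.aemeasurable, lintegral_prod _ hg.aemeasurable,
    lintegral_prod _ hh.aemeasurable]
  exact hμ hf.lintegral_prod_right' hg.lintegral_prod_right' hh.lintegral_prod_right' ha hb hab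
    fun x y => hν (hf.comp measurable_prodMk_left) (hg.comp measurable_prodMk_left)
      (hh.comp measurable_prodMk_left) ha hb hab fun z w => hfgh (x, z) (y, w)

theorem map (hμ : PrekopaLeindler μ) (e : E →ₗ[ℝ] F) (he : Measurable e) :
    PrekopaLeindler (μ.map e) := by
  intro f g h a b hf hg hh ha hb hab hfgh
  rw [lintegral_map hf he, lintegral_map hg he, lintegral_map hh he]
  exact hμ (hf.comp he) (hg.comp he) (hh.comp he) ha hb hab fun x y => by
    simpa using hfgh (e x) (e y)

theorem smul_measure (hμ : PrekopaLeindler μ) (c : ℝ≥0∞) : PrekopaLeindler (c • μ) := by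
  intro f g h a b hf hg hh ha hb hab hfgh
  simp only [lintegral_smul_measure, smul_eq_mul]
  calc (c * ∫⁻ x, f x ∂μ) ^ a * (c * ∫⁻ x, g x ∂μ) ^ b
      = c * ((∫⁻ x, f x ∂μ) ^ a * (∫⁻ x, g x ∂μ) ^ b) := by
        rw [ENNReal.mul_rpow_of_nonneg _ _ ha.le, ENNReal.mul_rpow_of_nonneg _ _ hb.le,
          mul_mul_mul_comm, ← ENNReal.rpow_add_of_nonneg _ _ ha.le hb.le, hab, ENNReal.rpow_one]
    _ ≤ c * ∫⁻ x, h x ∂μ := by gcongr; exact hμ hf hg hh ha hb hab hfgh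

theorem volume_pi (n : ℕ) : PrekopaLeindler (volume : Measure (Fin n → ℝ)) := by
  induction n with
  | zero => exact Measure.volume_pi_eq_dirac (0 : Fin 0 → ℝ) ▸ dirac_zero
  | succ n ih =>
    let e := (Fin.consLinearEquiv ℝ fun _ : Fin (n + 1) => ℝ).toLinearMap
    have he : ⇑e = (MeasurableEquiv.piFinSuccAbove (fun _ : Fin (n + 1) => ℝ) 0).symm :=
      funext fun p => (Fin.insertNth_zero' p.1 p.2).symm
    have hpres : MeasurePreserving e :=
      he ▸ (volume_preserving_piFinSuccAbove (fun _ : Fin (n + 1) => ℝ) 0).symm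
    exact hpres.map_eq ▸ (volume_real.prod ih).map e hpres.measurable

theorem of_isAddHaarMeasure {E : Type*} [NormedAddCommGroup E] [NormedSpace ℝ E]
    [FiniteDimensional ℝ E] [MeasurableSpace E] [BorelSpace E] (μ : Measure E)
    [μ.IsAddHaarMeasure] : PrekopaLeindler μ := by
  let e := (Module.finBasis ℝ E).equivFunL.symm
  rw [Measure.isAddLeftInvariant_eq_smul μ (volume.map e)]
  exact ((volume_pi _).map e.toLinearMap e.continuous.measurable).smul_measure _

end PrekopaLeindler

theorem concaveOn_log_of_rpow_mul_rpow_le {E : Type*} [AddCommGroup E] [Module ℝ E] {s : Set E}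
    {φ : E → ℝ} (hs : Convex ℝ s) (hφ : ∀ x ∈ s, 0 < φ x)
    (h : ∀ x ∈ s, ∀ y ∈ s, ∀ a b : ℝ, 0 < a → 0 < b → a + b = 1 →
      φ x ^ a * φ y ^ b ≤ φ (a • x + b • y)) :
    ConcaveOn ℝ s fun x => Real.log (φ x) := by
  refine concaveOn_iff_forall_pos.2 ⟨hs, fun x hx y hy a b ha hb hab => ?_⟩
  have hx₀ := Real.rpow_pos_of_pos (hφ x hx) a
  have hy₀ := Real.rpow_pos_of_pos (hφ y hy) b
  calc a • Real.log (φ x) + b • Real.log (φ y) = Real.log (φ x ^ a * φ y ^ b) := by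
        rw [Real.log_mul hx₀.ne' hy₀.ne', Real.log_rpow (hφ x hx), Real.log_rpow (hφ y hy),
          smul_eq_mul, smul_eq_mul]
    _ ≤ Real.log (φ (a • x + b • y)) :=
        Real.log_le_log (mul_pos hx₀ hy₀) (h x hx y hy a b ha hb hab)

theorem lintegral_comp_inv_smul_addHaar {E : Type*} [NormedAddCommGroup E] [NormedSpace ℝ E]
    [FiniteDimensional ℝ E] [MeasurableSpace E] [BorelSpace E] (μ : Measure E)
    [μ.IsAddHaarMeasure] {g : E → ℝ≥0∞} (hg : Measurable g) {t : ℝ} (ht : 0 < t) :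
    ∫⁻ x, g (t⁻¹ • x) ∂μ = ENNReal.ofReal (t ^ Module.finrank ℝ E) * ∫⁻ x, g x ∂μ := by
  rw [← lintegral_map hg (measurable_const_smul t⁻¹),
    Measure.map_addHaar_smul μ (inv_ne_zero ht.ne'), lintegral_smul_measure, smul_eq_mul, inv_pow,
    inv_inv, abs_of_pos (pow_pos ht _)]

namespace LogConcave

section Module

variable {E : Type*} [AddCommGroup E] [Module ℝ E] {f : E → ℝ}

theorem convex_setOf_pos (hf : LogConcave f) : Convex ℝ {x | 0 < f x} :=
  convex_iff_forall_pos.2 fun x hx y hy a b ha hb hab =>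
    (mul_pos (Real.rpow_pos_of_pos hx a) (Real.rpow_pos_of_pos hy b)).trans_le
      (hf.rpow_mul_rpow_le x y a b ha hb hab)

theorem concaveOn_log (hf : LogConcave f) : ConcaveOn ℝ {x | 0 < f x} fun x => Real.log (f x) :=
  concaveOn_log_of_rpow_mul_rpow_le hf.convex_setOf_pos (fun _ hx => hx)
    fun x _ y _ => hf.rpow_mul_rpow_le x y

theorem indicator (hf : LogConcave f) {C : Set E} (hC : Convex ℝ C) :
    LogConcave (C.indicator f) := by
  have hnonneg := Set.indicator_nonneg (s := C) fun x _ => hf.nonneg x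
  refine ⟨hnonneg, fun x y a b ha hb hab => ?_⟩
  by_cases hx : x ∈ C
  · by_cases hy : y ∈ C
    · rw [Set.indicator_of_mem hx, Set.indicator_of_mem hy,
        Set.indicator_of_mem (hC hx hy ha.le hb.le hab)]
      exact hf.rpow_mul_rpow_le x y a b ha hb hab
    · simpa [Set.indicator_of_notMem hy, Real.zero_rpow hb.ne'] using hnonneg _
  · simpa [Set.indicator_of_notMem hx, Real.zero_rpow ha.ne'] using hnonneg _

theorem perspective (hf : LogConcave f) {s u a b : ℝ} (hs : 0 < s) (hu : 0 < u) (ha : 0 < a)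
    (hb : 0 < b) (x y : E) :
    (f (s⁻¹ • x) ^ s) ^ a * (f (u⁻¹ • y) ^ u) ^ b ≤
      f ((a * s + b * u)⁻¹ • (a • x + b • y)) ^ (a * s + b * u) := by
  set t := a * s + b * u with ht
  have ht₀ : 0 < t := by positivity
  have hpoint : (a * s / t) • s⁻¹ • x + (b * u / t) • u⁻¹ • y = t⁻¹ • (a • x + b • y) := by
    simp only [smul_add, smul_smul]
    congr 2 <;> field_simp
  have hweights : a * s / t + b * u / t = 1 := by rw [← add_div, ← ht, div_self ht₀.ne']
  have hpow (z : E) {r c : ℝ} : (f z ^ r) ^ c = (f z ^ (c * r / t)) ^ t := by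
    rw [← Real.rpow_mul (hf.nonneg z), ← Real.rpow_mul (hf.nonneg z), div_mul_cancel₀ _ ht₀.ne',
      mul_comm]
  have hf₀ (z : E) (c : ℝ) : 0 ≤ f z ^ c := Real.rpow_nonneg (hf.nonneg z) c
  calc (f (s⁻¹ • x) ^ s) ^ a * (f (u⁻¹ • y) ^ u) ^ b
      = (f (s⁻¹ • x) ^ (a * s / t) * f (u⁻¹ • y) ^ (b * u / t)) ^ t := by
        rw [hpow (s⁻¹ • x), hpow (u⁻¹ • y), Real.mul_rpow (hf₀ _ _) (hf₀ _ _)]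
    _ ≤ f (t⁻¹ • (a • x + b • y)) ^ t := by
        rw [← hpoint]
        exact Real.rpow_le_rpow (mul_nonneg (hf₀ _ _) (hf₀ _ _))
          (hf.rpow_mul_rpow_le _ _ _ _ (by positivity) (by positivity) hweights) ht₀.le

end Module

variable {E : Type*} [NormedAddCommGroup E] [NormedSpace ℝ E] [FiniteDimensional ℝ E]
  [MeasurableSpace E] [BorelSpace E] {f : E → ℝ}

theorem measurable_indicator_interior (hf : LogConcave f) :
    Measurable ((interior {x | 0 < f x}).indicator f) := by
  classical
  have hcont : ContinuousOn f (interior {x | 0 < f x}) :=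
    hf.concaveOn_log.continuousOn_interior.rexp.congr fun x hx =>
      (Real.exp_log (interior_subset hx : x ∈ {x | 0 < f x})).symm
  rw [← Set.piecewise_eq_indicator]
  exact hcont.measurable_piecewise continuousOn_const isOpen_interior.measurableSet

theorem indicator_interior_ae_eq (hf : LogConcave f) (μ : Measure E) [μ.IsAddHaarMeasure] :
    (interior {x | 0 < f x}).indicator f =ᵐ[μ] f := by
  have hfrontier := measure_eq_zero_iff_ae_notMem.1 (hf.convex_setOf_pos.addHaar_frontier μ)
  filter_upwards [hfrontier] with x hx
  by_cases hxi : x ∈ interior {x | 0 < f x}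
  · exact Set.indicator_of_mem hxi f
  · have hx₀ : f x ≤ 0 := not_lt.1 fun hpos => hx ⟨subset_closure hpos, hxi⟩
    rw [Set.indicator_of_notMem hxi, le_antisymm hx₀ (hf.nonneg x)]

theorem aemeasurable (hf : LogConcave f) (μ : Measure E) [μ.IsAddHaarMeasure] :
    AEMeasurable f μ :=
  ⟨_, hf.measurable_indicator_interior, (hf.indicator_interior_ae_eq μ).symm⟩

variable {μ : Measure E} [μ.IsAddHaarMeasure]

theorem pow_mul_lintegral_rpow (hf : LogConcave f) {s u a b : ℝ} (hs : 0 < s) (hu : 0 < u)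
    (ha : 0 < a) (hb : 0 < b) (hab : a + b = 1) :
    (ENNReal.ofReal (s ^ Module.finrank ℝ E) * ∫⁻ x, ENNReal.ofReal (f x ^ s) ∂μ) ^ a *
        (ENNReal.ofReal (u ^ Module.finrank ℝ E) * ∫⁻ x, ENNReal.ofReal (f x ^ u) ∂μ) ^ b ≤
      ENNReal.ofReal ((a * s + b * u) ^ Module.finrank ℝ E) *
        ∫⁻ x, ENNReal.ofReal (f x ^ (a * s + b * u)) ∂μ := by
  set g := (interior {x | 0 < f x}).indicator f
  have hg : LogConcave g := hf.indicator hf.convex_setOf_pos.interior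
  have hgf : g =ᵐ[μ] f := hf.indicator_interior_ae_eq μ
  have hgm (t : ℝ) : Measurable fun x => ENNReal.ofReal (g x ^ t) :=
    (hf.measurable_indicator_interior.pow_const t).ennreal_ofReal
  have hscale {t : ℝ} (ht : 0 < t) :
      ENNReal.ofReal (t ^ Module.finrank ℝ E) * ∫⁻ x, ENNReal.ofReal (f x ^ t) ∂μ =
        ∫⁻ x, ENNReal.ofReal (g (t⁻¹ • x) ^ t) ∂μ := by
    rw [lintegral_comp_inv_smul_addHaar μ (hgm t) ht]
    congr 1
    refine lintegral_congr_ae ?_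
    filter_upwards [hgf] with x hx
    rw [hx]
  rw [hscale hs, hscale hu, hscale (by positivity)]
  refine PrekopaLeindler.of_isAddHaarMeasure μ ((hgm s).comp (measurable_const_smul _))
    ((hgm u).comp (measurable_const_smul _)) ((hgm _).comp (measurable_const_smul _)) ha hb hab
    fun x y => ?_
  have hg₀ (z : E) (r : ℝ) : 0 ≤ g z ^ r := Real.rpow_nonneg (hg.nonneg z) r
  rw [ENNReal.ofReal_rpow_of_nonneg (hg₀ _ _) ha.le, ENNReal.ofReal_rpow_of_nonneg (hg₀ _ _) hb.le,
    ← ENNReal.ofReal_mul (Real.rpow_nonneg (hg₀ _ _) _)]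
  exact ENNReal.ofReal_le_ofReal (hg.perspective hs hu ha hb x y)

theorem lintegral_rpow_ne_zero (hf : LogConcave f) (hne : ¬f =ᵐ[μ] 0) {t : ℝ} (ht : 0 < t) :
    ∫⁻ x, ENNReal.ofReal (f x ^ t) ∂μ ≠ 0 := by
  rw [Ne, lintegral_eq_zero_iff' ((hf.aemeasurable μ).pow_const t).ennreal_ofReal]
  refine mt (fun h => ?_) hne
  filter_upwards [h] with x hx
  have hpow := (ENNReal.ofReal_eq_zero.1 hx).antisymm (Real.rpow_nonneg (hf.nonneg x) t)
  exact (Real.rpow_eq_zero (hf.nonneg x) ht.ne').1 hpow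

theorem integrable_rpow (hf : LogConcave f) (hint : Integrable f μ) {t : ℝ} (ht : 0 < t) :
    Integrable (fun x => f x ^ t) μ := by
  have hmeas := ((hf.aemeasurable μ).pow_const t).aestronglyMeasurable
  by_cases hne : f =ᵐ[μ] 0
  · refine (integrable_zero E ℝ μ).congr ?_
    filter_upwards [hne] with x hx
    simp [hx, ht.ne']
  refine (lintegral_ofReal_ne_top_iff_integrable hmeas
    (.of_forall fun x => Real.rpow_nonneg (hf.nonneg x) t)).1 fun htop => ?_
  -- `1` is a convex combination of `t` and `t⁻¹`, and `∫ f ^ t⁻¹ > 0`.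
  have hweights : 1 / (t + 1) * t + t / (t + 1) * t⁻¹ = 1 := by field_simp
  have hle := hf.pow_mul_lintegral_rpow (μ := μ) (a := 1 / (t + 1)) (b := t / (t + 1)) ht
    (inv_pos.2 ht) (by positivity) (by positivity) (by field_simp; ring)
  have hpos : ENNReal.ofReal (t⁻¹ ^ Module.finrank ℝ E) *
      ∫⁻ x, ENNReal.ofReal (f x ^ t⁻¹) ∂μ ≠ 0 :=
    mul_ne_zero (ENNReal.ofReal_pos.2 (by positivity)).ne'
      (hf.lintegral_rpow_ne_zero hne (inv_pos.2 ht))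
  rw [htop, hweights, ENNReal.mul_top (ENNReal.ofReal_pos.2 (by positivity)).ne',
    ENNReal.top_rpow_of_pos (by positivity),
    ENNReal.top_mul (ENNReal.rpow_eq_zero_iff_of_pos (by positivity) |>.not.2 hpos)] at hle
  simpa using hint.lintegral_lt_top.ne (by simpa using hle)

theorem integral_rpow_pos (hf : LogConcave f) (hint : Integrable f μ) (hne : ¬f =ᵐ[μ] 0) {t : ℝ}
    (ht : 0 < t) : 0 < ∫ x, f x ^ t ∂μ := by
  rw [← ENNReal.ofReal_pos, ofReal_integral_eq_lintegral_ofReal (hf.integrable_rpow hint ht)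
    (.of_forall fun x => Real.rpow_nonneg (hf.nonneg x) t)]
  exact pos_of_ne_zero (hf.lintegral_rpow_ne_zero hne ht)

theorem concaveOn_log_integral_rpow (hf : LogConcave f) (hint : Integrable f μ)
    (hne : ¬f =ᵐ[μ] 0) :
    ConcaveOn ℝ (Set.Ioi 0) fun t =>
      Module.finrank ℝ E * Real.log t + Real.log (∫ x, f x ^ t ∂μ) := by
  set φ : ℝ → ℝ := fun t => t ^ Module.finrank ℝ E * ∫ x, f x ^ t ∂μ
  have hpos : ∀ t ∈ Set.Ioi (0 : ℝ), 0 < φ t := fun t ht =>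
    mul_pos (pow_pos ht _) (hf.integral_rpow_pos hint hne ht)
  have hofReal {t : ℝ} (ht : 0 < t) : ENNReal.ofReal (φ t) =
      ENNReal.ofReal (t ^ Module.finrank ℝ E) * ∫⁻ x, ENNReal.ofReal (f x ^ t) ∂μ := by
    rw [ENNReal.ofReal_mul (pow_pos ht _).le,
      ofReal_integral_eq_lintegral_ofReal (hf.integrable_rpow hint ht)
        (.of_forall fun x => Real.rpow_nonneg (hf.nonneg x) t)]
  refine (concaveOn_log_of_rpow_mul_rpow_le (convex_Ioi 0) hpos fun s hs u hu a b ha hb hab => ?_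
    ).congr fun t ht => ?_
  · have ht : 0 < a * s + b * u := add_pos (mul_pos ha hs) (mul_pos hb hu)
    rw [smul_eq_mul, smul_eq_mul, ← ENNReal.ofReal_le_ofReal_iff (hpos _ ht).le,
      ENNReal.ofReal_mul (Real.rpow_nonneg (hpos s hs).le a),
      ← ENNReal.ofReal_rpow_of_pos (hpos s hs), ← ENNReal.ofReal_rpow_of_pos (hpos u hu),
      hofReal hs, hofReal hu, hofReal ht]
    exact hf.pow_mul_lintegral_rpow hs hu ha hb hab
  · simp only [φ]
    rw [Real.log_mul (pow_pos ht _).ne' (hf.integral_rpow_pos hint hne ht).ne', Real.log_pow]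

end LogConcave

section DensityLaw

variable {Ω E : Type*} [MeasurableSpace Ω] [MeasurableSpace E] {P : Measure Ω} {μ : Measure E}
  {X : Ω → E} {f : E → ℝ} {t : ℝ}

theorem mul_exp_mul_log {y : ℝ} (hy : 0 ≤ y) (ht : -1 < t) :
    y * Real.exp (t * Real.log y) = y ^ (1 + t) := by
  rcases hy.eq_or_lt with rfl | hy
  · rw [zero_mul, Real.zero_rpow (by linarith)]
  · rw [Real.rpow_add hy, Real.rpow_one, Real.rpow_def_of_pos hy, mul_comm t]

theorem aestronglyMeasurable_map_of_map_eq_withDensity {g : E → ℝ} {ρ : E → ℝ≥0∞}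
    (hlaw : P.map X = μ.withDensity ρ) (hg : AEMeasurable g μ) :
    AEStronglyMeasurable g (P.map X) :=
  (hg.mono_ac (hlaw ▸ withDensity_absolutelyContinuous μ ρ)).aestronglyMeasurable

theorem integrable_exp_mul_log_comp_iff (hX : AEMeasurable X P)
    (hlaw : P.map X = μ.withDensity fun x => ENNReal.ofReal (f x)) (hfm : AEMeasurable f μ)
    (hf : ∀ x, 0 ≤ f x) (ht : -1 < t) :
    Integrable (fun ω => Real.exp (t * Real.log (f (X ω)))) P ↔
      Integrable (fun x => f x ^ (1 + t)) μ := by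
  have hmeas := aestronglyMeasurable_map_of_map_eq_withDensity hlaw (hfm.log.const_mul t).exp
  have hpow (x : E) :
      (ENNReal.ofReal (f x)).toReal • Real.exp (t * Real.log (f x)) = f x ^ (1 + t) := by
    rw [ENNReal.toReal_ofReal (hf x), smul_eq_mul, mul_exp_mul_log (hf x) ht]
  rw [← funext hpow, ← integrable_withDensity_iff_integrable_smul₀' hfm.ennreal_ofReal
    (.of_forall fun x => ENNReal.ofReal_lt_top), ← hlaw]
  exact (integrable_map_measure hmeas hX).symm

theorem mgf_log_comp (hX : AEMeasurable X P)
    (hlaw : P.map X = μ.withDensity fun x => ENNReal.ofReal (f x)) (hfm : AEMeasurable f μ)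
    (hf : ∀ x, 0 ≤ f x) (ht : -1 < t) :
    mgf (fun ω => Real.log (f (X ω))) P t = ∫ x, f x ^ (1 + t) ∂μ := by
  have hmeas := aestronglyMeasurable_map_of_map_eq_withDensity hlaw (hfm.log.const_mul t).exp
  rw [mgf, ← integral_map hX hmeas, hlaw, integral_withDensity_eq_integral_toReal_smul₀
    hfm.ennreal_ofReal (.of_forall fun x => ENNReal.ofReal_lt_top)]
  congr! 2 with x
  rw [ENNReal.toReal_ofReal (hf x), smul_eq_mul, mul_exp_mul_log (hf x) ht]

end DensityLaw

section ConcaveCgf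

variable {Ω : Type*} [MeasurableSpace Ω] {P : Measure Ω} {Y : Ω → ℝ} {d t : ℝ}

theorem sub_log_one_add_le (ht : -(3 / 4) ≤ t) : t - Real.log (1 + t) ≤ 4 * t ^ 2 := by
  have hpos : 0 < 1 + t := by linarith
  have hlog := Real.one_sub_inv_le_log_of_pos hpos
  have hinv : (1 + t)⁻¹ ≤ 1 - t + 4 * t ^ 2 := by
    rw [inv_le_iff_one_le_mul₀ hpos]
    nlinarith [mul_nonneg (sq_nonneg t) (by linarith : 0 ≤ 3 + 4 * t)]
  linarith

theorem le_add_mul_of_concaveOn_of_hasDerivAt {S : Set ℝ} {ψ : ℝ → ℝ} {x y ψ' : ℝ}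
    (hψ : ConcaveOn ℝ S ψ) (hx : x ∈ S) (hy : y ∈ S) (hderiv : HasDerivAt ψ ψ' x) :
    ψ y ≤ ψ x + ψ' * (y - x) := by
  rcases lt_trichotomy y x with hyx | rfl | hxy
  · have hslope := hψ.le_slope_of_hasDerivAt hy hx hyx hderiv
    rw [slope_def_field, le_div_iff₀ (sub_pos.2 hyx)] at hslope
    linarith
  · simp
  · have hslope := hψ.slope_le_of_hasDerivAt hx hy hxy hderiv
    rw [slope_def_field, div_le_iff₀ (sub_pos.2 hxy)] at hslope
    linarith

theorem cgf_le_of_concaveOn [IsProbabilityMeasure P]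
    (hY : 0 ∈ interior (integrableExpSet Y P))
    (hconc : ConcaveOn ℝ (Set.Ioi (-1)) fun t => d * Real.log (1 + t) + cgf Y P t)
    (ht : -1 < t) : cgf Y P t ≤ t * P[Y] + d * (t - Real.log (1 + t)) := by
  have hcgf : HasDerivAt (cgf Y P) P[Y] 0 := by
    simpa [deriv_cgf_zero hY] using (analyticAt_cgf hY).differentiableAt.hasDerivAt
  have hlog : HasDerivAt (fun t : ℝ => Real.log (1 + t)) 1 0 := by
    simpa using ((hasDerivAt_id (0 : ℝ)).const_add 1).log (by simp)
  have htangent := le_add_mul_of_concaveOn_of_hasDerivAt hconc (by simp) ht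
    ((hlog.const_mul d).add hcgf)
  simp only [add_zero, Real.log_one, mul_zero, cgf_zero, sub_zero, zero_add] at htangent
  linarith

theorem mgf_sub_integral_le_of_concaveOn [IsProbabilityMeasure P] (hd : 0 ≤ d)
    (hY : Set.Ioi (-1) ⊆ integrableExpSet Y P)
    (hconc : ConcaveOn ℝ (Set.Ioi (-1)) fun t => d * Real.log (1 + t) + cgf Y P t)
    (ht : -(3 / 4) ≤ t) : mgf (fun ω => Y ω - P[Y]) P t ≤ Real.exp (4 * d * t ^ 2) := by
  have hY₀ : 0 ∈ interior (integrableExpSet Y P) :=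
    interior_maximal hY isOpen_Ioi (by simp)
  have ht₁ : -1 < t := by linarith
  simp only [sub_eq_add_neg]
  rw [mgf_add_const, ← exp_cgf (hY ht₁), ← Real.exp_add, Real.exp_le_exp]
  have hcgf := cgf_le_of_concaveOn hY₀ hconc ht₁
  have hlog := mul_le_mul_of_nonneg_left (sub_log_one_add_le ht) hd
  linarith

theorem integrableExpSet_sub_const (Y : Ω → ℝ) (P : Measure Ω) (c : ℝ) :
    integrableExpSet (fun ω => Y ω - c) P = integrableExpSet Y P := by
  ext t
  simp [integrableExpSet, mul_sub, Real.exp_sub, div_eq_mul_inv, integrable_mul_const_iff]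

theorem integral_exp_mul_abs_le {Z : Ω → ℝ} (ht : t ∈ integrableExpSet Z P)
    (hnt : -t ∈ integrableExpSet Z P) :
    ∫ ω, Real.exp (t * |Z ω|) ∂P ≤ mgf Z P t + mgf Z P (-t) := by
  rw [mgf, mgf, ← integral_add ht hnt]
  refine integral_mono (integrable_exp_mul_abs ht hnt) (ht.add hnt) fun ω => ?_
  rcases abs_choice (Z ω) with h | h <;> simp only [h, mul_neg, neg_mul]
  · exact le_add_of_nonneg_right (Real.exp_pos _).le
  · exact le_add_of_nonneg_left (Real.exp_pos _).le

theorem integral_exp_mul_abs_sub_integral_le_of_concaveOn [IsProbabilityMeasure P] (hd : 0 ≤ d)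
    (hY : Set.Ioi (-1) ⊆ integrableExpSet Y P)
    (hconc : ConcaveOn ℝ (Set.Ioi (-1)) fun t => d * Real.log (1 + t) + cgf Y P t)
    (ht : |t| ≤ 3 / 4) :
    Integrable (fun ω => Real.exp (t * |Y ω - P[Y]|)) P ∧
      ∫ ω, Real.exp (t * |Y ω - P[Y]|) ∂P ≤ 2 * Real.exp (4 * d * t ^ 2) := by
  obtain ⟨ht₁, ht₂⟩ := abs_le.1 ht
  have hmem {s : ℝ} (hs : -(3 / 4) ≤ s) :
      s ∈ integrableExpSet (fun ω => Y ω - P[Y]) P := by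
    rw [integrableExpSet_sub_const]
    exact hY (lt_of_lt_of_le (by norm_num) hs)
  have hpos := mgf_sub_integral_le_of_concaveOn hd hY hconc ht₁
  have hneg := mgf_sub_integral_le_of_concaveOn hd hY hconc (neg_le_neg ht₂)
  have habs := integral_exp_mul_abs_le (hmem ht₁) (hmem (neg_le_neg ht₂))
  rw [neg_sq] at hneg
  exact ⟨integrable_exp_mul_abs (hmem ht₁) (hmem (neg_le_neg ht₂)), by linarith⟩

end ConcaveCgf

section LogConcaveDensity

variable {Ω E : Type*} [MeasurableSpace Ω] [NormedAddCommGroup E] [NormedSpace ℝ E]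
  [FiniteDimensional ℝ E] [MeasurableSpace E] [BorelSpace E] {P : Measure Ω}
  [IsProbabilityMeasure P] {μ : Measure E} [μ.IsAddHaarMeasure] {X : Ω → E} {f : E → ℝ}

namespace LogConcave

theorem integrable_of_map_eq_withDensity (hf : LogConcave f) (hX : AEMeasurable X P)
    (hlaw : P.map X = μ.withDensity fun x => ENNReal.ofReal (f x)) : Integrable f μ := by
  simpa using (integrable_exp_mul_log_comp_iff (t := 0) hX hlaw (hf.aemeasurable μ) hf.nonneg
    (by norm_num)).1 (by simp)

theorem not_ae_eq_zero_of_map_eq_withDensity (hf : LogConcave f) (hX : AEMeasurable X P)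
    (hlaw : P.map X = μ.withDensity fun x => ENNReal.ofReal (f x)) : ¬f =ᵐ[μ] 0 := by
  intro hzero
  have hone := mgf_log_comp (t := 0) hX hlaw (hf.aemeasurable μ) hf.nonneg (by norm_num)
  simp [integral_congr_ae hzero] at hone

theorem Ioi_subset_integrableExpSet_log (hf : LogConcave f) (hX : AEMeasurable X P)
    (hlaw : P.map X = μ.withDensity fun x => ENNReal.ofReal (f x)) :
    Set.Ioi (-1) ⊆ integrableExpSet (fun ω => Real.log (f (X ω))) P := fun t ht =>
  (integrable_exp_mul_log_comp_iff hX hlaw (hf.aemeasurable μ) hf.nonneg ht).2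
    (hf.integrable_rpow (hf.integrable_of_map_eq_withDensity hX hlaw) (by linarith [ht.out]))

theorem concaveOn_add_cgf_log (hf : LogConcave f) (hX : AEMeasurable X P)
    (hlaw : P.map X = μ.withDensity fun x => ENNReal.ofReal (f x)) :
    ConcaveOn ℝ (Set.Ioi (-1)) fun t =>
      Module.finrank ℝ E * Real.log (1 + t) + cgf (fun ω => Real.log (f (X ω))) P t := by
  have hconc := (hf.concaveOn_log_integral_rpow (hf.integrable_of_map_eq_withDensity hX hlaw)
    (hf.not_ae_eq_zero_of_map_eq_withDensity hX hlaw)).translate_right 1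
  rw [Set.preimage_const_add_Ioi, zero_sub] at hconc
  refine hconc.congr fun t ht => ?_
  rw [cgf, mgf_log_comp hX hlaw (hf.aemeasurable μ) hf.nonneg ht, Function.comp_apply]

end LogConcave

theorem theorem7p1_general (hX : AEMeasurable X P)
    (hlaw : P.map X = μ.withDensity fun x => ENNReal.ofReal (f x)) (hf : LogConcave f) :
    Integrable (fun ω => Real.log (f (X ω))) P ∧
    ∀ t : ℝ, |t| ≤ 3 / 4 →
      Integrable (fun ω => Real.exp (t *
        |Real.log (f (X ω)) - ∫ ω', Real.log (f (X ω')) ∂P|)) P ∧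
      ∫ ω, Real.exp (t * |Real.log (f (X ω)) - ∫ ω', Real.log (f (X ω')) ∂P|) ∂P
        ≤ 2 * Real.exp (4 * Module.finrank ℝ E * t ^ 2) := by
  have hexp := hf.Ioi_subset_integrableExpSet_log hX hlaw
  have hzero : 0 ∈ interior (integrableExpSet (fun ω => Real.log (f (X ω))) P) :=
    interior_maximal hexp isOpen_Ioi (by simp)
  exact ⟨integrable_of_mem_interior_integrableExpSet hzero, fun t =>
    integral_exp_mul_abs_sub_integral_le_of_concaveOn (Nat.cast_nonneg _) hexp
      (hf.concaveOn_add_cgf_log hX hlaw)⟩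

end LogConcaveDensity

theorem theorem7p1 {Ω : Type*} [MeasurableSpace Ω] (P : Measure Ω) [IsProbabilityMeasure P]
    (n : ℕ) (hn : 1 ≤ n)
    (X : Ω → EuclideanSpace ℝ (Fin n)) (f : EuclideanSpace ℝ (Fin n) → ℝ)
    (hX : HasLebesgueDensity P X f) (hf : LogConcave f) :
    Integrable (fun ω => Real.log (f (X ω))) P ∧
    ∀ α : ℝ, 0 ≤ α → α ≤ Real.sqrt n / 4 →
      Integrable (fun ω => Real.exp (α / Real.sqrt n *
        |Real.log (f (X ω)) - ∫ ω', Real.log (f (X ω')) ∂P|)) P ∧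
      ∫ ω, Real.exp (α / Real.sqrt n *
        |Real.log (f (X ω)) - ∫ ω', Real.log (f (X ω')) ∂P|) ∂P
        ≤ 3 * Real.exp (4 * α ^ 2) := by
  have hgeneral := theorem7p1_general hX.aemeasurable_vector hX.map_eq hf
  refine ⟨hgeneral.1, fun α hα₀ hα => ?_⟩
  have hn₀ : (0 : ℝ) < n := Nat.cast_pos.2 hn
  have hsqrt : 0 < Real.sqrt n := Real.sqrt_pos.2 hn₀
  have ht : |α / Real.sqrt n| ≤ 3 / 4 := by
    rw [abs_of_nonneg (by positivity), div_le_iff₀ hsqrt]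
    linarith
  refine (hgeneral.2 _ ht).imp_right fun hle => hle.trans ?_
  rw [finrank_euclideanSpace_fin, mul_assoc, div_pow, Real.sq_sqrt hn₀.le,
    mul_div_cancel₀ _ hn₀.ne']
  gcongr
  norm_num
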